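/- **Setting.** A queue event is either an enqueue $\mathtt{enq}^{uid}(x)$ with $x\in\mathbb N$ or a dequeue $\mathtt{deq}^{uid}(v)$ returning $v\in\mathbb N\cup\{\mathtt{NULL}\}$, where $uid\in\mathbb N$ is an identifier; $\mathrm{Val}(e)$ denotes the value enqueued or returned. A *behavior* is a finite sequence of events with pairwise distinct identifiers. It is *legal* for the queue if it is the trace of a run, from the empty state $\varepsilon$, of the transition system on finite sequences over $\mathbb N$ with transitions $q\xrightarrow{\mathtt{enq}(x)}q\cdot x$, $\;x\cdot q\xrightarrow{\mathtt{deq}(x)}q$ and $\varepsilon\xrightarrow{\mathtt{deq}(\mathtt{NULL})}\varepsilon$. Each event $a$ generates an invocation $inv(a)$ and a response $res(a)$, both carrying its identifier; the invocation of an enqueue carries its argument, and the response of a dequeue carries its return value. A *history* is a finite sequence $c$ of such actions that is well-formed: each identifier has at most one invocation and at most one response in $c$, and every response occurs after its matching invocation. An event is *pending* in $c$ if only its invocation occurs in $c$, and $c$ is *complete* if it has no pending event. A *completion* of $c$ is a well-formed complete history $\hat c$ that arises by appending some sequence of response actions to $c$ and then deleting all events that are still pending; $\mathrm{Compl}(c)$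 is the set of completions. Write $e\prec_c e'$ if $res(e)$ occurs before $inv(e')$ in $c$, and $\mathrm{Before}_c(e)=\{e'\mid e'\prec_c e\}$. $\mathrm{Enq}(c)$ and $\mathrm{Deq}(c)$ are the sets of enqueue and dequeue events of $c$. A history is *sequential* if every invocation in it, except possibly the very last action, is immediately followed by its matching response; complete sequential histories are identified with behaviors. A sequential history $s$ is a *linearization* of $c$ if there is $\hat c\in\mathrm{Compl}(c)$ such that $s$ is a permutation of $\hat c$ and $e\prec_{\hat c}e'$ implies $e\prec_s e'$. A history $c$ is *linearizable with respect to the queue* if it has a linearization that is a legal queue behavior; a set of histories is linearizable if each of its members is. Let $c$ be a complete history and $M:\mathrm{Deq}(c)\to\mathrm{Enq}(c)\cup\{\bot\}$ a total map. * $M$ is *safe* if for all $d,d'\in\mathrm{Deq}(c)$: $M(d)\ne\bot$ implies $\mathrm{Val}(d)=\mathrm{Val}(M(d))$; $M(d)=\bot$ iff $\mathrm{Val}(d)=\mathtt{NULL}$; and $M(d)=M(d')\neq\bot$ implies $d=d'$. * A safe $M$ is *ordered* if $d\not\prec_c M(d)$ for all $d\in \mathrm{Deq}(c)$ with $M(d)\ne\bot$,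 and whenever $e\in\mathrm{Enq}(c)$, $d'\in\mathrm{Deq}(c)$, $M(d')\neq\bot$ and $e\prec_c M(d')$, there is $d\in\mathrm{Deq}(c)$ with $M(d)=e$ and $d'\not\prec_c d$. * For $d_\bot\in\mathrm{Deq}(c)$ with $\mathrm{Val}(d_\bot)=\mathtt{NULL}$ let $\mathrm{Bad}(d_\bot)=\bigcup_{i\in\mathbb N}\mathrm{Bad}^i(d_\bot)$, where $\mathrm{Bad}^0(d_\bot)$ is the set of $e\in\mathrm{Enq}(c)$ such that $d_\bot\prec_c e$ or every $d\in\mathrm{Deq}(c)$ with $M(d)=e$ satisfies $d_\bot\prec_c d$, and $\mathrm{Bad}^{i+1}(d_\bot)$ is the set of $e\in\mathrm{Enq}(c)$ for which there is $e'\in\mathrm{Bad}^i(d_\bot)$ with $e'\prec_c e$, or with $e'\prec_c d$ for some $d\in\mathrm{Deq}(c)$ with $M(d)=e$. * An ordered $M$ is a *linearization witness* for $c$ if $\mathrm{Bad}(d)\cap\mathrm{Before}_c(d)=\emptyset$ for every $d\in\mathrm{Deq}(c)$ with $\mathrm{Val}(d)=\mathtt{NULL}$. **Theorem.** A set $C$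 of histories is linearizable with respect to the queue if and only if every $c\in C$ has a completion $\hat c\in\mathrm{Compl}(c)$ that has a linearization witness. -/

import Mathlib

namespace QueueLin

/-- Queue events. `enq uid x` is the enqueue of the natural number `x`; `deq uid v` is a dequeue
that returns `v`, where `none` is the distinguished value `NULL`. -/
inductive Event where
  | enq (uid : ℕ) (x : ℕ)
  | deq (uid : ℕ) (v : Option ℕ)

/-- Invocation and response actions of the queue methods. An enqueue has no output and a dequeue
has no input, so the value of a dequeue shows only in its response. -/
inductive Action where
  | enqInv (uid : ℕ) (x : ℕ)
  | enqRes (uid : ℕ)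
  | deqInv (uid : ℕ)
  | deqRes (uid : ℕ) (v : Option ℕ)

namespace Event

def uid : Event → ℕ
  | enq u _ => u
  | deq u _ => u

/-- The value enqueued or dequeued by the event (`none` is `NULL`). -/
def val : Event → Option ℕ
  | enq _ x => some x
  | deq _ v => v

def IsEnq : Event → Prop
  | enq _ _ => True
  | deq _ _ => False

def IsDeq : Event → Prop
  | enq _ _ => False
  | deq _ _ => True

/-- The invocation generated by an event. -/
def inv : Event → Action
  | enq u x => Action.enqInv u x
  | deq u _ => Action.deqInv u

/-- The response generated by an event. -/
def res : Event → Action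
  | enq u _ => Action.enqRes u
  | deq u v => Action.deqRes u v

end Event

namespace Action

def uid : Action → ℕ
  | enqInv u _ => u
  | enqRes u => u
  | deqInv u => u
  | deqRes u _ => u

def isInv : Action → Bool
  | enqInv _ _ => true
  | enqRes _ => false
  | deqInv _ => true
  | deqRes _ _ => false

/-- `a` and `r` are the invocation and the response of one and the same event. -/
def Matching (a r : Action) : Prop := ∃ e : Event, a = e.inv ∧ r = e.res

end Action

/-! ### Legal queue behaviors -/

/-- A behavior is a duplicate-free sequence of events; event identifiers are unique. -/
def IsBehavior (b : List Event) : Prop := (b.map Event.uid).Nodup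

/-- The transitions of the queue, whose states are sequences of natural numbers. -/
inductive Step : List ℕ → Event → List ℕ → Prop where
  | enq (q : List ℕ) (u x : ℕ) : Step q (Event.enq u x) (q ++ [x])
  | deq (q : List ℕ) (u x : ℕ) : Step (x :: q) (Event.deq u (some x)) q
  | deqNull (u : ℕ) : Step [] (Event.deq u none) []

/-- `Run q b q'`: there is a run from state `q` to state `q'` with trace `b`. -/
inductive Run : List ℕ → List Event → List ℕ → Prop where
  | nil (q : List ℕ) : Run q [] q
  | cons {q q' q'' : List ℕ} {a : Event} {b : List Event} :
      Step q a q' → Run q' b q'' → Run q (a :: b) q''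

/-- The queue specification: the behaviors that are traces of runs from the empty queue. -/
def queueSpec : Set (List Event) := {b | IsBehavior b ∧ ∃ q, Run [] b q}

/-! ### Histories -/

/-- A sequence of actions is well-formed if each identifier has at most one invocation and at most
one response, and each response occurs after an invocation that it matches. -/
structure WellFormed (h : List Action) : Prop where
  unique : (h.map fun a => (a.uid, a.isInv)).Nodup
  inv_before_res : ∀ (j : ℕ) (r : Action), h[j]? = some r → r.isInv = false →
    ∃ (i : ℕ) (a : Action), i < j ∧ h[i]? = some a ∧ Action.Matching a r

/-- The invocation `a` is pending in `c`: no response in `c` matches it. -/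
def IsPending (c : List Action) (a : Action) : Prop :=
  a.isInv = true ∧ ¬ ∃ r ∈ c, Action.Matching a r

/-- A history is complete if it has no pending event. -/
def Complete (c : List Action) : Prop := ∀ a ∈ c, ¬ IsPending c a

open Classical in
/-- The sub-sequence of `c` where all pending events have been removed. -/
noncomputable def remPending (c : List Action) : List Action :=
  c.filter fun a => decide (¬ IsPending c a)

/-- The completions of `c`: the well-formed complete histories obtained by appending some
responses to `c` and then removing the events that are still pending. -/
def Compl (c : List Action) : Set (List Action) :=
  {ch | WellFormed ch ∧ Complete ch ∧
    ∃ c' : List Action, (∀ a ∈ c', a.isInv = false) ∧ ch = remPending (c ++ c')}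

/-- The completed events of `c`. In a complete history these are all the events of `c`. -/
def events (c : List Action) : Set Event := {e | e.inv ∈ c ∧ e.res ∈ c}

/-- The enqueue events of a complete history. -/
def Enq (c : List Action) : Set Event := {e | e ∈ events c ∧ e.IsEnq}

/-- The dequeue events of a complete history. -/
def Deq (c : List Action) : Set Event := {d | d ∈ events c ∧ d.IsDeq}

/-- The response of `e` occurs in `h` before the invocation of `e'`. -/
def Precedes (h : List Action) (e e' : Event) : Prop :=
  ∃ i j : ℕ, i < j ∧ h[i]? = some e.res ∧ h[j]? = some e'.inv

/-- The set of events that precede `e` in `c`. -/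
def Before (c : List Action) (e : Event) : Set Event := {e' | e' ∈ events c ∧ Precedes c e' e}

/-! ### Linearizability -/

/-- Each invocation is immediately followed by its matching response, with the possible exception
of the very last action. -/
def Sequential (s : List Action) : Prop :=
  ∀ (i : ℕ) (a : Action), s[i]? = some a → a.isInv = true → i + 1 < s.length →
    ∃ r : Action, s[i + 1]? = some r ∧ Action.Matching a r

/-- The sequential history `s` is a linearization of the history `c`. -/
def IsLinearization (c s : List Action) : Prop :=
  WellFormed s ∧ Sequential s ∧
    ∃ ch ∈ Compl c, ch.Perm s ∧
      ∀ e ∈ events ch, ∀ e' ∈ events ch, Precedes ch e e' → Precedes s e e'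

/-- The complete sequential history that is identified with the behavior `b`. -/
def toHistory (b : List Event) : List Action := b.flatMap fun e => [e.inv, e.res]

/-- `c` is linearizable with respect to the data structure whose legal behaviors are `L`. -/
def Linearizable (L : Set (List Event)) (c : List Action) : Prop :=
  ∃ b ∈ L, IsLinearization c (toHistory b)

/-- A set of histories is linearizable if each of its members is. -/
def LinearizableSet (L : Set (List Event)) (C : Set (List Action)) : Prop :=
  ∀ c ∈ C, Linearizable L c

/-! ### Linearization witnesses

A total mapping from `Deq c` to `Enq c ∪ {⊥}` is a function `M : Event → Option Event` that sends
each dequeue of `c` to `none` (which stands for `⊥`) or to an enqueue of `c`; its values outside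
`Deq c` are never used. -/

structure IsSafe (c : List Action) (M : Event → Option Event) : Prop where
  mapsTo : ∀ d ∈ Deq c, ∀ e, M d = some e → e ∈ Enq c
  val_eq : ∀ d ∈ Deq c, ∀ e, M d = some e → d.val = e.val
  null_iff : ∀ d ∈ Deq c, M d = none ↔ d.val = none
  inj : ∀ d ∈ Deq c, ∀ d' ∈ Deq c, M d = M d' → M d ≠ none → d = d'

structure IsOrdered (c : List Action) (M : Event → Option Event) : Prop extends IsSafe c M where
  not_deq_precedes : ∀ d ∈ Deq c, ∀ e, M d = some e → ¬ Precedes c d e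
  fifo : ∀ e ∈ Enq c, ∀ d' ∈ Deq c, ∀ e', M d' = some e' → Precedes c e e' →
    ∃ d ∈ Deq c, M d = some e ∧ ¬ Precedes c d' d

/-- The stages of the inductive definition of `Bad`. -/
def BadLevel (c : List Action) (M : Event → Option Event) (d₀ : Event) : ℕ → Set Event
  | 0 => {e | e ∈ Enq c ∧
      (Precedes c d₀ e ∨ ∀ d ∈ Deq c, M d = some e → Precedes c d₀ d)}
  | i + 1 => {e | e ∈ Enq c ∧
      ∃ e' ∈ BadLevel c M d₀ i,
        Precedes c e' e ∨ ∃ d ∈ Deq c, M d = some e ∧ Precedes c e' d}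

def Bad (c : List Action) (M : Event → Option Event) (d₀ : Event) : Set Event :=
  ⋃ i : ℕ, BadLevel c M d₀ i

structure IsLinearizationWitness (c : List Action) (M : Event → Option Event) : Prop
    extends IsOrdered c M where
  null_witness : ∀ d ∈ Deq c, d.val = none → Bad c M d ∩ Before c d = ∅

end QueueLin

namespace QueueLin

/-! A legal behavior determines which dequeue takes which enqueue, and this matching is a witness.
The delicate clause concerns `NULL`: such a dequeue `d₀` meets an empty queue, so every enqueue
before it was also taken before it. By induction on the level, each bad enqueue therefore comes
after `d₀` in the behavior and cannot precede it in the history (`exists_fifoOrder_of_run`,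
`FifoOrder.isLinearizationWitness`).

Conversely, a witness yields linearization points. An enqueue `p` has its own interval `[a p, b p]`
and the interval `[a' p, b' p]` of the dequeue taking it. Wanted are points `X p ≤ Y p` in these
intervals that order the enqueues and their dequeues alike, and a time `t` for each `NULL` dequeue
with no `X p < t ≤ Y p`, so that the queue is empty at `t`. The condition on `Bad` supplies a `t`
such that an enqueue whose dequeue is forced to `t` or later can itself wait until `t`
(`exists_null_time`). Under this condition and the FIFO clause the constraints on the order of the
enqueues are acyclic (`exists_compatible_rank`), and running maxima along that order give the points
(`exists_schedule`). Sorting by points, with ties broken suitably, produces a `FifoOrder`, which is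
a run of the queue (`FifoOrder.run_of_prefix`). -/

noncomputable instance : DecidableEq Event := Classical.decEq _

noncomputable instance : DecidableEq Action := Classical.decEq _

namespace Event

@[simp] theorem uid_inv (e : Event) : e.inv.uid = e.uid := by cases e <;> rfl

@[simp] theorem uid_res (e : Event) : e.res.uid = e.uid := by cases e <;> rfl

@[simp] theorem isInv_inv (e : Event) : e.inv.isInv = true := by cases e <;> rfl

@[simp] theorem isInv_res (e : Event) : e.res.isInv = false := by cases e <;> rfl

theorem inv_ne_res (e e' : Event) : e.inv ≠ e'.res := fun h => by
  simpa using congrArg Action.isInv h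

theorem eq_of_inv_of_res {e e' : Event} (h : e.inv = e'.inv) (h' : e.res = e'.res) : e = e' := by
  cases e <;> cases e' <;> simp_all [inv, res]

theorem not_isDeq {e : Event} (h : e.IsEnq) : ¬ e.IsDeq := by
  cases e <;> simp_all [IsEnq, IsDeq]

theorem isEnq_or_isDeq (e : Event) : e.IsEnq ∨ e.IsDeq := by
  cases e <;> simp [IsEnq, IsDeq]

end Event

/-! ### Positions of invocations and responses in a history -/

section WellFormed

variable {h : List Action}

theorem WellFormed.nodup (hw : WellFormed h) : h.Nodup := hw.unique.of_map

theorem WellFormed.eq_of_uid (hw : WellFormed h) {a b : Action} (ha : a ∈ h) (hb : b ∈ h)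
    (hu : a.uid = b.uid) (hi : a.isInv = b.isInv) : a = b :=
  List.inj_on_of_nodup_map hw.unique ha hb (by simp [hu, hi])

theorem WellFormed.event_eq (hw : WellFormed h) {e e' : Event} (he : e ∈ events h)
    (he' : e' ∈ events h) (hu : e.uid = e'.uid) : e = e' :=
  Event.eq_of_inv_of_res (hw.eq_of_uid he.1 he'.1 (by simpa) (by simp))
    (hw.eq_of_uid he.2 he'.2 (by simpa) (by simp))

theorem events_finite (h : List Action) : (events h).Finite := by
  refine Set.Finite.of_finite_image (f := fun e => (e.inv, e.res)) ?_ ?_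
  · refine ((List.finite_toSet h).prod (List.finite_toSet h)).subset ?_
    rintro _ ⟨e, he, rfl⟩
    exact he
  · intro e _ e' _ hee
    exact Event.eq_of_inv_of_res (congrArg Prod.fst hee) (congrArg Prod.snd hee)

/-- The position of the invocation of `e` in `h`. -/
noncomputable def invPos (h : List Action) (e : Event) : ℕ := h.idxOf e.inv

/-- The position of the response of `e` in `h`. -/
noncomputable def resPos (h : List Action) (e : Event) : ℕ := h.idxOf e.res

theorem getElem?_eq_some_iff_idxOf {α : Type*} [DecidableEq α] {l : List α} (hl : l.Nodup) {x : α}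
    (hx : x ∈ l) {i : ℕ} : l[i]? = some x ↔ i = l.idxOf x := by
  constructor
  · intro hi
    obtain ⟨hi', rfl⟩ := List.getElem?_eq_some_iff.1 hi
    exact (hl.idxOf_getElem i hi').symm
  · rintro rfl
    exact List.getElem?_idxOf hx

theorem precedes_iff (hn : h.Nodup) {e e' : Event} (he : e ∈ events h) (he' : e' ∈ events h) :
    Precedes h e e' ↔ resPos h e < invPos h e' := by
  simp only [Precedes, getElem?_eq_some_iff_idxOf hn he.2, getElem?_eq_some_iff_idxOf hn he'.1]
  constructor
  · rintro ⟨_, _, hij, rfl, rfl⟩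
    exact hij
  · intro hlt
    exact ⟨_, _, hlt, rfl, rfl⟩

theorem WellFormed.invPos_lt_resPos (hw : WellFormed h) {e : Event} (he : e ∈ events h) :
    invPos h e < resPos h e := by
  obtain ⟨i, a, hi, ha, e₀, rfl, hr⟩ :=
    hw.inv_before_res (h.idxOf e.res) e.res (List.getElem?_idxOf he.2) (by simp)
  have hmem : e₀.inv ∈ h := List.mem_of_getElem? ha
  have hu : e.uid = e₀.uid := by simpa using congrArg Action.uid hr
  have heq := hw.eq_of_uid hmem he.1 (by simp [hu]) (by simp)
  rw [heq, getElem?_eq_some_iff_idxOf hw.nodup he.1] at ha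
  subst ha
  exact hi

theorem invPos_ne_resPos {e e' : Event} (he : e ∈ events h) :
    invPos h e ≠ resPos h e' := fun heq =>
  Event.inv_ne_res e e' ((List.idxOf_inj he.1).1 heq)

theorem resPos_lt_length {e : Event} (he : e ∈ events h) : resPos h e < h.length :=
  List.idxOf_lt_length_of_mem he.2

theorem WellFormed.eq_of_resPos_eq (hw : WellFormed h) {e e' : Event} (he : e ∈ events h)
    (he' : e' ∈ events h) (hp : resPos h e = resPos h e') : e = e' :=
  hw.event_eq he he' (by simpa using congrArg Action.uid ((List.idxOf_inj he.2).1 hp))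

/-- Every action of a complete history belongs to one of its events. -/
theorem mem_iff_of_complete (hw : WellFormed h) (hc : Complete h) (a : Action) :
    a ∈ h ↔ ∃ e ∈ events h, a = e.inv ∨ a = e.res := by
  constructor
  · intro ha
    rcases hi : a.isInv with _ | _
    · obtain ⟨j, hj⟩ := List.getElem?_of_mem ha
      obtain ⟨i, a', -, ha', e, rfl, rfl⟩ := hw.inv_before_res j a hj hi
      exact ⟨e, ⟨List.mem_of_getElem? ha', ha⟩, Or.inr rfl⟩
    · have := hc a ha
      simp only [IsPending, hi, true_and, not_not] at this
      obtain ⟨r, hr, e, rfl, rfl⟩ := this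
      exact ⟨e, ⟨ha, hr⟩, Or.inl rfl⟩
  · rintro ⟨e, he, rfl | rfl⟩
    exacts [he.1, he.2]

end WellFormed

/-! ### Behaviors as sequential histories -/

section ToHistory

variable {b : List Event}

theorem toHistory_cons (e : Event) (b : List Event) :
    toHistory (e :: b) = e.inv :: e.res :: toHistory b := rfl

theorem mem_toHistory {a : Action} : a ∈ toHistory b ↔ ∃ e ∈ b, a = e.inv ∨ a = e.res := by
  simp [toHistory]

theorem getElem?_toHistory_two_mul (b : List Event) (i : ℕ) :
    (toHistory b)[2 * i]? = b[i]?.map Event.inv := by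
  induction b generalizing i with
  | nil => rfl
  | cons e b ih =>
    cases i with
    | zero => rfl
    | succ i => simpa [toHistory_cons, Nat.mul_succ] using ih i

theorem getElem?_toHistory_two_mul_add_one (b : List Event) (i : ℕ) :
    (toHistory b)[2 * i + 1]? = b[i]?.map Event.res := by
  induction b generalizing i with
  | nil => rfl
  | cons e b ih =>
    cases i with
    | zero => rfl
    | succ i => simpa [toHistory_cons, Nat.mul_succ] using ih i

theorem wellFormed_toHistory (hb : IsBehavior b) : WellFormed (toHistory b) := by
  constructor
  · induction b with
    | nil => simp [toHistory]
    | cons e b ih =>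
      simp only [IsBehavior, List.map_cons, List.nodup_cons] at hb
      have hne : ∀ t, (e.uid, t) ∉ (toHistory b).map fun a => (a.uid, a.isInv) := by
        intro t ht
        obtain ⟨a, ha, hat⟩ := List.mem_map.1 ht
        obtain ⟨e', he', rfl | rfl⟩ := mem_toHistory.1 ha <;>
        · simp only [Prod.mk.injEq, Event.uid_inv, Event.uid_res] at hat
          exact hb.1 (List.mem_map.2 ⟨e', he', hat.1⟩)
      simp only [toHistory_cons, List.map_cons, List.nodup_cons, Event.uid_inv, Event.uid_res,
        Event.isInv_inv, Event.isInv_res, List.mem_cons, Prod.mk.injEq, not_or]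
      exact ⟨⟨by simp, hne _⟩, hne _, ih hb.2⟩
  · intro j r hj hr
    obtain ⟨i, rfl | rfl⟩ := Nat.even_or_odd' j
    · rw [getElem?_toHistory_two_mul] at hj
      obtain ⟨e, -, rfl⟩ := Option.map_eq_some_iff.1 hj
      simp at hr
    · rw [getElem?_toHistory_two_mul_add_one] at hj
      obtain ⟨e, he, rfl⟩ := Option.map_eq_some_iff.1 hj
      exact ⟨2 * i, e.inv, by omega, by rw [getElem?_toHistory_two_mul, he]; rfl, e, rfl, rfl⟩

theorem sequential_toHistory (b : List Event) : Sequential (toHistory b) := by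
  intro j a hj ha _
  obtain ⟨i, rfl | rfl⟩ := Nat.even_or_odd' j
  · rw [getElem?_toHistory_two_mul] at hj
    obtain ⟨e, he, rfl⟩ := Option.map_eq_some_iff.1 hj
    exact ⟨e.res, by rw [getElem?_toHistory_two_mul_add_one, he]; rfl, e, rfl, rfl⟩
  · rw [getElem?_toHistory_two_mul_add_one] at hj
    obtain ⟨e, he, rfl⟩ := Option.map_eq_some_iff.1 hj
    simp at ha

theorem mem_events_toHistory (hb : IsBehavior b) {e : Event} : e ∈ events (toHistory b) ↔ e ∈ b := by
  constructor
  · rintro he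
    obtain ⟨e', he', h | h⟩ := mem_toHistory.1 he.1
    · have h' : e' ∈ events (toHistory b) :=
        ⟨mem_toHistory.2 ⟨e', he', Or.inl rfl⟩, mem_toHistory.2 ⟨e', he', Or.inr rfl⟩⟩
      rwa [(wellFormed_toHistory hb).event_eq he h' (by simpa using congrArg Action.uid h)]
    · exact absurd h (Event.inv_ne_res _ _)
  · intro he
    exact ⟨mem_toHistory.2 ⟨e, he, Or.inl rfl⟩, mem_toHistory.2 ⟨e, he, Or.inr rfl⟩⟩

theorem precedes_toHistory_iff (hb : IsBehavior b) {e e' : Event} (he : e ∈ b) (he' : e' ∈ b) :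
    Precedes (toHistory b) e e' ↔ b.idxOf e < b.idxOf e' := by
  have hw := (wellFormed_toHistory hb).nodup
  have hE := (mem_events_toHistory hb).2 he
  have hE' := (mem_events_toHistory hb).2 he'
  -- The event at index `k` of `b` has its invocation at `2 * k` and its response at `2 * k + 1`.
  have h₁ : 2 * b.idxOf e + 1 = resPos (toHistory b) e := by
    rw [resPos, ← getElem?_eq_some_iff_idxOf hw hE.2, getElem?_toHistory_two_mul_add_one,
      List.getElem?_idxOf he]; rfl
  have h₂ : 2 * b.idxOf e' = invPos (toHistory b) e' := by
    rw [invPos, ← getElem?_eq_some_iff_idxOf hw hE'.1, getElem?_toHistory_two_mul,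
      List.getElem?_idxOf he']; rfl
  rw [precedes_iff hw hE hE', ← h₁, ← h₂]
  omega

end ToHistory

/-! ### Queue runs and FIFO matchings -/

section Runs

theorem Run.snoc {q q' q'' : List ℕ} {b : List Event} {a : Event} (h : Run q b q')
    (hs : Step q' a q'') : Run q (b ++ [a]) q'' := by
  induction h with
  | nil q => exact .cons hs (.nil _)
  | cons hs' _ ih => exact .cons hs' (ih hs)

theorem Run.exists_of_snoc {q q'' : List ℕ} {b : List Event} {a : Event}
    (h : Run q (b ++ [a]) q'') : ∃ q', Run q b q' ∧ Step q' a q'' := by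
  induction b generalizing q with
  | nil =>
    rcases h with _ | ⟨hs, hr⟩
    rcases hr with _ | _
    exact ⟨q, .nil q, hs⟩
  | cons c b ih =>
    rcases h with _ | ⟨hs, hr⟩
    obtain ⟨q', hq', hs'⟩ := ih hr
    exact ⟨q', .cons hs hq', hs'⟩

/-- The argument of an enqueue. -/
def Event.content : Event → ℕ
  | enq _ x => x
  | deq _ _ => 0

open Classical in
/-- The enqueues of `l` that no event of `l` is matched with, in the order of `l`. -/
noncomputable def waiting (M : Event → Option Event) (l : List Event) : List Event :=
  l.filter fun e => e.IsEnq ∧ ∀ d ∈ l, M d ≠ some e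

variable {κ : Type*} [LinearOrder κ]

/-- The matching `M` explains the behavior that lists the events of `b` by increasing `f`. -/
structure FifoOrder (b : List Event) (M : Event → Option Event) (f : Event → κ) : Prop where
  enq_lt : ∀ d ∈ b, ∀ e, M d = some e → e ∈ b ∧ e.IsEnq ∧ d.IsDeq ∧ d.val = e.val ∧ f e < f d
  null_iff : ∀ d ∈ b, d.IsDeq → (M d = none ↔ d.val = none)
  inj : ∀ d ∈ b, ∀ d' ∈ b, ∀ e, M d = some e → M d' = some e → d = d'
  fifo : ∀ e ∈ b, e.IsEnq → ∀ d' ∈ b, ∀ e', M d' = some e' → f e < f e' →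
    ∃ d ∈ b, M d = some e ∧ f d < f d'
  empty : ∀ d ∈ b, d.IsDeq → d.val = none → ∀ e ∈ b, e.IsEnq → f e < f d →
    ∃ d' ∈ b, M d' = some e ∧ f d' < f d

variable {b : List Event} {M : Event → Option Event} {f : Event → κ}

theorem waiting_snoc_enq {l : List Event} {a : Event} (ha : a.IsEnq) (hM : M a = none)
    (hl : ∀ d ∈ l, M d ≠ some a) : waiting M (l ++ [a]) = waiting M l ++ [a] := by
  simp only [waiting, List.filter_append]
  congr 1
  · refine List.filter_congr fun e _ => ?_
    simp [or_imp, forall_and, hM]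
  · simp only [List.filter_cons, List.filter_nil]
    rw [if_pos]
    simp only [decide_eq_true_eq]
    refine ⟨ha, fun d hd => ?_⟩
    rcases List.mem_append.1 hd with hd | hd
    · exact hl d hd
    · simp [List.mem_singleton.1 hd, hM]

theorem waiting_snoc_null {l : List Event} {a : Event} (ha : a.IsDeq) (hM : M a = none) :
    waiting M (l ++ [a]) = waiting M l := by
  simp only [waiting, List.filter_append]
  rw [List.filter_cons_of_neg, List.filter_nil, List.append_nil]
  · refine List.filter_congr fun e _ => ?_
    simp [or_imp, forall_and, hM]
  · simp only [decide_eq_true_eq]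
    exact fun h => Event.not_isDeq h.1 ha

/-- Matching a new dequeue with the front of the queue removes exactly the front, because a
duplicate-free list contains it only once. -/
theorem waiting_snoc_deq {l rest : List Event} {a e : Event} (hl : l.Nodup) (ha : a.IsDeq)
    (hM : M a = some e) (hw : waiting M l = e :: rest) : waiting M (l ++ [a]) = rest := by
  have hrest : e ∉ rest := by
    have : (waiting M l).Nodup := hl.filter _
    rw [hw] at this
    exact (List.nodup_cons.1 this).1
  have : waiting M (l ++ [a]) = (waiting M l).filter (fun x => decide (x ≠ e)) := by
    simp only [waiting, List.filter_append, List.filter_filter]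
    rw [List.filter_cons_of_neg, List.filter_nil, List.append_nil]
    · refine List.filter_congr fun x _ => ?_
      rw [Bool.eq_iff_iff]
      simp only [Bool.and_eq_true, decide_eq_true_eq, List.mem_append, List.mem_singleton, or_imp, forall_and, forall_eq, hM, ne_eq,
        Option.some.injEq, eq_comm (a := x)]
      tauto
    · simp only [decide_eq_true_eq]
      exact fun h => Event.not_isDeq h.1 ha
  rw [this, hw, List.filter_cons_of_neg (by simp)]
  exact List.filter_eq_self.2 fun x hx => by
    simp only [decide_eq_true_eq]
    rintro rfl
    exact hrest hx

theorem mem_waiting {l : List Event} {e : Event} :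
    e ∈ waiting M l ↔ e ∈ l ∧ e.IsEnq ∧ ∀ d ∈ l, M d ≠ some e := by
  simp [waiting]

/-- The state reached after a prefix is the list of its waiting enqueues; each new event is checked
to be a legal step from that state. -/
theorem FifoOrder.run_of_prefix (hF : FifoOrder b M f) (hb : b.Pairwise fun x y => f x < f y)
    {l : List Event} (hl : l <+: b) : Run [] l ((waiting M l).map Event.content) := by
  induction l using List.reverseRecOn with
  | nil => exact .nil _
  | append_singleton l a ih =>
    have hlb : l <+: b := (List.prefix_append l [a]).trans hl
    refine (ih hlb).snoc ?_
    obtain ⟨t, rfl⟩ := hl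
    have hab : a ∈ l ++ [a] ++ t := by simp
    have hsub : ∀ x ∈ l, x ∈ l ++ [a] ++ t := fun x hx => by simp [hx]
    rw [List.append_assoc, List.pairwise_append] at hb
    obtain ⟨hpl, hpt, hcross⟩ := hb
    have hla : ∀ x ∈ l, f x < f a := fun x hx => hcross x hx a (by simp)
    have hmem : ∀ x ∈ l ++ [a] ++ t, f x < f a → x ∈ l := by
      intro x hx hxa
      simp only [List.mem_append, List.mem_singleton] at hx
      rcases hx with (hx | rfl) | hx
      · exact hx
      · exact absurd hxa (lt_irrefl _)
      · exact absurd hxa (lt_asymm ((List.pairwise_cons.1 hpt).1 x hx))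
    have hnd : l.Nodup := hpl.imp fun h heq => by subst heq; exact lt_irrefl _ h
    rcases a with ⟨u, x⟩ | ⟨u, _ | x⟩
    · have hM : M (.enq u x) = none := by
        by_contra hne
        obtain ⟨e, he⟩ := Option.ne_none_iff_exists'.1 hne
        exact (hF.enq_lt _ hab e he).2.2.1
      rw [waiting_snoc_enq (a := .enq u x) trivial hM]
      · simpa [Event.content] using Step.enq _ u x
      · intro d hd hde
        exact lt_asymm (hla d hd) (hF.enq_lt d (hsub d hd) _ hde).2.2.2.2
    · rw [waiting_snoc_null (a := .deq u none) trivial ((hF.null_iff _ hab trivial).2 rfl)]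
      have : waiting M l = [] := by
        refine List.eq_nil_iff_forall_not_mem.2 fun e he => ?_
        obtain ⟨hel, heq, hno⟩ := mem_waiting.1 he
        obtain ⟨d, hd, hde, hlt⟩ := hF.empty _ hab trivial rfl e (hsub e hel) heq (hla e hel)
        exact hno d (hmem d hd hlt) hde
      simpa [this] using Step.deqNull u
    · obtain ⟨e, he⟩ := Option.ne_none_iff_exists'.1
        (mt (hF.null_iff _ hab trivial).1 (by simp [Event.val]))
      obtain ⟨heb, heq, -, hval, hlt⟩ := hF.enq_lt _ hab e he
      have hel := hmem e heb hlt
      have hew : e ∈ waiting M l := mem_waiting.2 ⟨hel, heq, fun d hd hde => by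
        have := hF.inj _ hab d (hsub d hd) e he hde
        subst this
        exact lt_irrefl _ (hla _ hd)⟩
      -- If some other `e'` were at the front, it would be earlier than `e`, so `fifo` would have it
      -- taken before the current dequeue, and it would no longer be waiting.
      obtain ⟨rest, hrest⟩ : ∃ rest, waiting M l = e :: rest := by
        rcases hw : waiting M l with _ | ⟨e', rest⟩
        · simp [hw] at hew
        · rw [hw, List.mem_cons] at hew
          rcases hew with rfl | hew
          · exact ⟨rest, rfl⟩
          · have hpw : (waiting M l).Pairwise fun x y => f x < f y := hpl.filter _
            rw [hw, List.pairwise_cons] at hpw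
            obtain ⟨hel', heq', hno⟩ := mem_waiting.1 (hw ▸ List.mem_cons_self : e' ∈ waiting M l)
            obtain ⟨d, hd, hde, hlt'⟩ :=
              hF.fifo e' (hsub e' hel') heq' _ hab e he (hpw.1 e hew)
            exact absurd hde (hno d (hmem d hd hlt'))
      rw [waiting_snoc_deq (a := .deq u (some x)) hnd trivial he hrest, hrest]
      have hx : e.content = x := by
        cases e <;> simp_all [Event.val, Event.content, Event.IsEnq]
      simpa [hx] using Step.deq (rest.map Event.content) u x

theorem FifoOrder.congr {M' : Event → Option Event} (hF : FifoOrder b M f)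
    (h : ∀ d ∈ b, M' d = M d) : FifoOrder b M' f where
  enq_lt d hd e he := hF.enq_lt d hd e (h d hd ▸ he)
  null_iff d hd := h d hd ▸ hF.null_iff d hd
  inj d hd d' hd' e he he' := hF.inj d hd d' hd' e (h d hd ▸ he) (h d' hd' ▸ he')
  fifo e he hq d' hd' e' he' hlt := by
    obtain ⟨d, hd, hde, hdd⟩ := hF.fifo e he hq d' hd' e' (h d' hd' ▸ he') hlt
    exact ⟨d, hd, (h d hd).trans hde, hdd⟩
  empty d hd hq hv e he hqe hlt := by
    obtain ⟨d', hd', hde, hdd⟩ := hF.empty d hd hq hv e he hqe hlt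
    exact ⟨d', hd', (h d' hd').trans hde, hdd⟩

theorem waiting_congr {M' : Event → Option Event} {l : List Event} (h : ∀ d ∈ l, M' d = M d) :
    waiting M' l = waiting M l := by
  refine List.filter_congr fun e _ => ?_
  simp +contextual [h]

/-- Appending a latest event only creates obligations for that event: if matched, it takes the
earliest waiting enqueue, and if it returns `NULL`, nothing waits. -/
theorem FifoOrder.snoc {l : List Event} {a : Event} (hF : FifoOrder l M f)
    (hla : ∀ x ∈ l, f x < f a)
    (hsome : ∀ e, M a = some e → a.IsDeq ∧ a.val = e.val ∧ e ∈ waiting M l ∧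
      ∀ e' ∈ waiting M l, ¬ f e' < f e)
    (hnone : a.IsDeq → (M a = none ↔ a.val = none))
    (hempty : a.IsDeq → a.val = none → waiting M l = []) : FifoOrder (l ++ [a]) M f := by
  have hmem : ∀ x, x ∈ l ++ [a] ↔ x ∈ l ∨ x = a := by simp
  have hold : ∀ x ∈ l ++ [a], ∀ y ∈ l, f x < f y → x ∈ l := by
    intro x hx y hy hlt
    rcases (hmem x).1 hx with hx | rfl
    · exact hx
    · exact absurd hlt (lt_asymm (hla y hy))
  have hmatched : ∀ x ∈ l ++ [a], x.IsEnq → x ∈ l → x ∉ waiting M l →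
      ∃ d ∈ l ++ [a], M d = some x ∧ f d < f a := by
    intro x _ hxq hxl hxw
    by_contra hno
    refine hxw (mem_waiting.2 ⟨hxl, hxq, fun d hd hde => hno ⟨d, ?_, hde, hla d hd⟩⟩)
    exact (hmem d).2 (Or.inl hd)
  have hcross : ∀ d ∈ l, ∀ e, M d = some e → M a ≠ some e := fun d hd e hde hae =>
    (mem_waiting.1 (hsome e hae).2.2.1).2.2 d hd hde
  constructor
  · intro d hd e he
    rcases (hmem d).1 hd with hd | rfl
    · obtain ⟨h, h'⟩ := hF.enq_lt d hd e he
      exact ⟨(hmem e).2 (Or.inl h), h'⟩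
    · obtain ⟨h₁, h₂, h₃, -⟩ := hsome e he
      obtain ⟨h₄, h₅, -⟩ := mem_waiting.1 h₃
      exact ⟨(hmem e).2 (Or.inl h₄), h₅, h₁, h₂, hla e h₄⟩
  · intro d hd hq
    rcases (hmem d).1 hd with hd | rfl
    · exact hF.null_iff d hd hq
    · exact hnone hq
  · intro d hd d' hd' e he he'
    rcases (hmem d).1 hd with hdl | rfl <;> rcases (hmem d').1 hd' with hdl' | rfl
    · exact hF.inj d hdl d' hdl' e he he'
    · exact absurd he' (hcross d hdl e he)
    · exact absurd he (hcross d' hdl' e he')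
    · rfl
  · intro e he hq d' hd' e' he' hlt
    rcases (hmem d').1 hd' with hd' | rfl
    · obtain ⟨d, hd, h⟩ := hF.fifo e (hold e he e' (hF.enq_lt d' hd' e' he').1 hlt) hq d' hd' e' he' hlt
      exact ⟨d, (hmem d).2 (Or.inl hd), h⟩
    · obtain ⟨-, -, h₃, h₄⟩ := hsome e' he'
      exact hmatched e he hq (hold e he e' (mem_waiting.1 h₃).1 hlt) fun hw => h₄ e hw hlt
  · intro d hd hq hv e he hqe hlt
    rcases (hmem d).1 hd with hd | rfl
    · obtain ⟨d', hd', h⟩ := hF.empty d hd hq hv e (hold e he d hd hlt) hqe hlt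
      exact ⟨d', (hmem d').2 (Or.inl hd'), h⟩
    · refine hmatched e he hqe ?_ (by simp [hempty hq hv])
      rcases (hmem e).1 he with he | rfl
      · exact he
      · exact absurd hq (Event.not_isDeq hqe)

/-- The matching is built along the run by giving each non-`NULL` dequeue the front of the waiting
list, whose contents are the queue state. -/
theorem exists_fifoOrder_of_run {q : List ℕ} (hb : b.Pairwise fun x y => f x < f y)
    (hr : Run [] b q) : ∃ M, FifoOrder b M f ∧ q = (waiting M b).map Event.content := by
  induction b using List.reverseRecOn generalizing q with
  | nil =>
    rcases hr with _ | _
    exact ⟨fun _ => none, by constructor <;> simp, rfl⟩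
  | append_singleton l a ih =>
    obtain ⟨q', hr', hs⟩ := hr.exists_of_snoc
    have hb' := List.pairwise_append.1 hb
    have hnd : l.Nodup := hb'.1.imp fun h heq => by subst heq; exact lt_irrefl _ h
    have hla : ∀ x ∈ l, f x < f a := fun x hx => hb'.2.2 x hx a (by simp)
    have hal : a ∉ l := fun h => lt_irrefl _ (hla a h)
    obtain ⟨M, hF, hq'⟩ := ih hb'.1 hr'
    -- Since `a` is not in `l`, its match can be prescribed freely without disturbing the matching
    -- on `l`.
    have key : ∀ o, ∃ M', FifoOrder l M' f ∧ q' = (waiting M' l).map Event.content ∧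
        waiting M' l = waiting M l ∧ M' a = o := fun o => by
      have hag : ∀ d ∈ l, Function.update M a o d = M d := fun d hd =>
        Function.update_of_ne (ne_of_mem_of_not_mem hd hal) _ _
      have hw := waiting_congr hag
      exact ⟨Function.update M a o, hF.congr hag, hw ▸ hq', hw, Function.update_self _ _ _⟩
    cases hs with
    | enq _ u x =>
      obtain ⟨M', hF', rfl, -, hM⟩ := key none
      refine ⟨M', hF'.snoc hla (by simp [hM]) (fun h => h.elim) (fun h => h.elim), ?_⟩
      rw [waiting_snoc_enq (a := .enq u x) trivial hM fun d hd h => hal (hF'.enq_lt d hd _ h).1]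
      simp [Event.content]
    | deqNull u =>
      obtain ⟨M', hF', hw', -, hM⟩ := key none
      have hw : waiting M' l = [] := List.map_eq_nil_iff.1 hw'.symm
      refine ⟨M', hF'.snoc hla (by simp [hM]) (fun _ => by simp [hM, Event.val])
        (fun _ _ => hw), ?_⟩
      rw [waiting_snoc_null (a := .deq u none) trivial hM, hw, List.map_nil]
    | deq _ u x =>
      obtain ⟨e, rest, hw, hx, hrest⟩ := List.map_eq_cons_iff.1 hq'.symm
      obtain ⟨M', hF', -, hww, hM⟩ := key (some e)
      rw [← hww] at hw
      have hew : e ∈ waiting M' l := hw ▸ List.mem_cons_self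
      have hp : (waiting M' l).Pairwise fun x y => f x < f y := hb'.1.filter _
      rw [hw, List.pairwise_cons] at hp
      refine ⟨M', hF'.snoc hla ?_ (fun _ => by simp [hM, Event.val])
        (fun _ h => by simp [Event.val] at h), ?_⟩
      · intro e₁ he₁
        obtain rfl : e = e₁ := by simpa [hM] using he₁
        refine ⟨trivial, ?_, hew, fun e' he' => ?_⟩
        · have := (mem_waiting.1 hew).2.1
          cases e <;> simp_all [Event.val, Event.content, Event.IsEnq]
        · rw [hw, List.mem_cons] at he'
          rcases he' with rfl | he'
          · exact lt_irrefl _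
          · exact lt_asymm (hp.1 e' he')
      · rw [waiting_snoc_deq (a := .deq u (some x)) hnd trivial hM hw, hrest]

end Runs

/-! ### Scheduling pairs of intervals -/

/-- Topological sorting by repeatedly removing an element without predecessors; `R` need not be
transitive. -/
theorem exists_rank {α : Type*} (S : Finset α) (R : α → α → Prop)
    (h : ∀ T ⊆ S, T.Nonempty → ∃ p ∈ T, ∀ q ∈ T, ¬ R q p) :
    ∃ r : α → ℕ, Set.InjOn r S ∧ ∀ p ∈ S, ∀ q ∈ S, R q p → r q < r p := by
  classical
  induction S using Finset.strongInduction with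
  | H S ih =>
    rcases S.eq_empty_or_nonempty with rfl | hS
    · exact ⟨fun _ => 0, by simp⟩
    obtain ⟨p, hp, hmin⟩ := h S subset_rfl hS
    obtain ⟨r, hinj, hr⟩ := ih (S.erase p) (Finset.erase_ssubset hp) fun T hT =>
      h T (hT.trans (Finset.erase_subset _ _))
    have hne : ∀ x ∈ S, x ≠ p → x ∈ S.erase p := fun x hx hxp => Finset.mem_erase.2 ⟨hxp, hx⟩
    refine ⟨fun x => if x = p then 0 else r x + 1, ?_, ?_⟩
    · intro x hx y hy hxy
      by_cases h₁ : x = p <;> by_cases h₂ : y = p <;> simp [h₁, h₂] at hxy ⊢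
      exact hinj (hne x hx h₁) (hne y hy h₂) hxy
    · intro x hx y hy hR
      have h₁ : x ≠ p := by rintro rfl; exact hmin y hy hR
      by_cases h₂ : y = p
      · simp [h₁, h₂]
      · simpa [h₁, h₂] using hr x (hne x hx h₁) y (hne y hy h₂) hR

theorem exists_sorted {α κ : Type*} [LinearOrder κ] (S : Finset α) (f : α → κ)
    (hf : Set.InjOn f S) : ∃ l : List α, (∀ x, x ∈ l ↔ x ∈ S) ∧ l.Pairwise fun x y => f x < f y := by
  classical
  induction S using Finset.induction_on_max_value f with
  | empty => exact ⟨[], by simp⟩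
  | insert a s ha hmax ih =>
    obtain ⟨l, hl, hp⟩ := ih (hf.mono (by simp))
    refine ⟨l ++ [a], by simp [hl, or_comm], List.pairwise_append.2 ⟨hp, by simp, ?_⟩⟩
    intro x hx y hy
    rw [List.mem_singleton.1 hy]
    have hxs := (hl x).1 hx
    refine lt_of_le_of_ne (hmax x hxs) fun heq => ha ?_
    rwa [← hf (by simp [hxs]) (by simp) heq]

/-- Two families of intervals `[a, b]` and `[a', b']` and a set `Θ` of separating times. If no pair
of intervals forces opposite orders, the indices can be ordered compatibly with all of them. -/
theorem exists_compatible_rank {α : Type*} (S : Finset α) (a b a' b' : α → ℕ) (Θ : Set ℕ)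
    (hab : ∀ p ∈ S, a p ≤ b p) (hab' : ∀ p ∈ S, a' p ≤ b' p) (hle : ∀ p ∈ S, a p ≤ b' p)
    (hfifo : ∀ p ∈ S, ∀ q ∈ S, b p < a q → a' p ≤ b' q)
    (hΘ : ∀ t ∈ Θ, ∀ p ∈ S, t ≤ max (a p) (a' p) → t ≤ b p) :
    ∃ r : α → ℕ, Set.InjOn r S ∧ ∀ p ∈ S, ∀ q ∈ S, r p ≤ r q →
      a p ≤ b q ∧ max (a p) (a' p) ≤ b' q ∧ ∀ t ∈ Θ, t ≤ max (a p) (a' p) → t ≤ b q := by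
  classical
  -- `L p` is the earliest value of the second point of `p` compatible with the first point lying
  -- before it.
  set L : α → ℕ := fun p => max (a p) (a' p) with hL
  have hΘ' : ∀ t ∈ Θ, ∀ p ∈ S, t ≤ L p → t ≤ b' p := by
    intro t _ p hp htp
    exact htp.trans (max_le (hle p hp) (hab' p hp))
  -- Three reasons force `q` before `p`: the first interval of `q` ends too early, its second one
  -- does, or a time of `Θ` separates `L q` from `L p`.
  obtain ⟨r, hinj, hr⟩ := exists_rank S
    (fun q p => b q < a p ∨ b' q < L p ∨ ∃ t ∈ Θ, L q < t ∧ t ≤ L p) (by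
      intro T hTS hT
      -- `T'` keeps the indices that no time of `Θ` forces behind another index of `T`.
      set T' := T.filter fun p => ∀ q ∈ T, ∀ t ∈ Θ, L q < t → ¬ t ≤ L p with hT'
      have hT'S : ∀ p ∈ T', p ∈ S := fun p hp => hTS (Finset.mem_filter.1 hp).1
      have hne : T'.Nonempty := by
        obtain ⟨m, hm, hmin⟩ := T.exists_min_image L hT
        exact ⟨m, Finset.mem_filter.2 ⟨hm, fun q hq t _ hlt htm =>
          absurd (hmin q hq) (by omega)⟩⟩
      -- It suffices to be minimal within `T'`: an index `q` outside it has some `t ∈ Θ` with `L p <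
      -- t`, while both intervals of `q` extend to `t` or beyond.
      have hred : ∀ p ∈ T', (∀ q ∈ T', a p ≤ b q ∧ L p ≤ b' q) → ∃ p ∈ T, ∀ q ∈ T,
          ¬ (b q < a p ∨ b' q < L p ∨ ∃ t ∈ Θ, L q < t ∧ t ≤ L p) := by
        intro p hp hall
        refine ⟨p, (Finset.mem_filter.1 hp).1, fun q hq => ?_⟩
        have hblock := (Finset.mem_filter.1 hp).2
        have hnb : ¬ ∃ t ∈ Θ, L q < t ∧ t ≤ L p := by
          rintro ⟨t, ht, h₁, h₂⟩
          exact hblock q hq t ht h₁ h₂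
        have hpq : a p ≤ b q ∧ L p ≤ b' q := by
          by_cases hq' : q ∈ T'
          · exact hall q hq'
          · simp only [hT', Finset.mem_filter, hq, true_and, not_forall, not_not] at hq'
            obtain ⟨q₀, hq₀, t, ht, h₁, h₂⟩ := hq'
            have h₃ := hblock q₀ hq₀ t ht h₁
            have h₄ := hΘ t ht q (hTS hq) h₂
            have h₅ := hΘ' t ht q (hTS hq) h₂
            have : a p ≤ L p := le_max_left _ _
            omega
        rintro (h | h | h)
        · omega
        · omega
        · exact hnb h
      obtain ⟨x, hx, hxmin⟩ := T'.exists_min_image b hne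
      obtain ⟨y, hy, hymin⟩ := T'.exists_min_image b' hne
      have hyL : L y ≤ b' y := max_le (hle y (hT'S y hy)) (hab' y (hT'S y hy))
      have hxb := hab x (hT'S x hx)
      -- The earliest ends in the two families give the only candidates. Normally `y` is minimal; if
      -- `x` must start before `y`, then `x` is, and `hfifo` bounds its second point by `b' y`.
      by_cases hxy : b x < a y
      · refine hred x hx fun q hq => ⟨hxb.trans (hxmin q hq), le_trans ?_ (hymin q hq)⟩
        refine max_le ?_ (hfifo x (hT'S x hx) y (hT'S y hy) hxy)
        have := hle y (hT'S y hy)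
        omega
      · exact hred y hy fun q hq =>
          ⟨(not_lt.1 hxy).trans (hxmin q hq), hyL.trans (hymin q hq)⟩)
  refine ⟨r, hinj, fun p hp q hq hpq => ⟨?_, ?_, fun t ht htp => ?_⟩⟩
  · by_contra h
    exact absurd (hr p hp q hq (Or.inl (not_le.1 h))) (not_lt.2 hpq)
  · by_contra h
    exact absurd (hr p hp q hq (Or.inr (Or.inl (not_le.1 h)))) (not_lt.2 hpq)
  · by_contra h
    have hlt : L q < t := by
      by_contra h'
      exact h (hΘ t ht q hq (not_lt.1 h'))
    exact absurd (hr p hp q hq (Or.inr (Or.inr ⟨t, ht, hlt, htp⟩))) (not_lt.2 hpq)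

/-- In the situation of `exists_compatible_rank` one can choose points `X p ∈ [a p, b p]` and
`Y p ∈ [a' p, b' p]` in the same weak order, no time of `Θ` separating `X p` from `Y p`. -/
theorem exists_schedule {α : Type*} (S : Finset α) (a b a' b' : α → ℕ) (Θ : Finset ℕ)
    (hab : ∀ p ∈ S, a p ≤ b p) (hab' : ∀ p ∈ S, a' p ≤ b' p) (hle : ∀ p ∈ S, a p ≤ b' p)
    (hfifo : ∀ p ∈ S, ∀ q ∈ S, b p < a q → a' p ≤ b' q)
    (hΘ : ∀ t ∈ Θ, ∀ p ∈ S, t ≤ max (a p) (a' p) → t ≤ b p) :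
    ∃ r X Y : α → ℕ, Set.InjOn r S ∧
      (∀ p ∈ S, a p ≤ X p ∧ X p ≤ b p ∧ a' p ≤ Y p ∧ Y p ≤ b' p ∧ X p ≤ Y p) ∧
      (∀ p ∈ S, ∀ q ∈ S, r p ≤ r q → X p ≤ X q ∧ Y p ≤ Y q) ∧
      ∀ t ∈ Θ, ∀ p ∈ S, X p < t → Y p < t := by
  obtain ⟨r, hinj, hr⟩ := exists_compatible_rank S a b a' b' Θ hab hab' hle hfifo hΘ
  let L : α → ℕ := fun p => max (a p) (a' p)
  -- `I p` pushes the first point up to the last time of `Θ` not exceeding `L p`, so that no such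
  -- time separates `I p` from `L p`. Taking suprema of `I` and `L` over all indices of lower or
  -- equal rank makes both points monotone.
  let I : α → ℕ := fun p => max (a p) ((Θ.filter (· ≤ L p)).sup id)
  let down : α → Finset α := fun p => S.filter fun q => r q ≤ r p
  have hdown : ∀ p q, q ∈ down p ↔ q ∈ S ∧ r q ≤ r p := fun p q => Finset.mem_filter
  have hself : ∀ p ∈ S, p ∈ down p := fun p hp => (hdown p p).2 ⟨hp, le_rfl⟩
  have hIL : ∀ p, I p ≤ L p := fun p =>
    max_le (le_max_left _ _) (Finset.sup_le fun t ht => (Finset.mem_filter.1 ht).2)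
  refine ⟨r, fun p => (down p).sup I, fun p => (down p).sup L, hinj, ?_, ?_, ?_⟩
  · intro p hp
    refine ⟨?_, ?_, ?_, ?_, ?_⟩
    · exact (le_max_left _ _).trans (Finset.le_sup (f := I) (hself p hp))
    · refine Finset.sup_le fun q hq => ?_
      obtain ⟨hqS, hqp⟩ := (hdown p q).1 hq
      obtain ⟨h₁, -, h₃⟩ := hr q hqS p hp hqp
      refine max_le h₁ (Finset.sup_le fun t ht => ?_)
      exact h₃ t (Finset.mem_filter.1 ht).1 (Finset.mem_filter.1 ht).2
    · exact (le_max_right _ _).trans (Finset.le_sup (f := L) (hself p hp))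
    · refine Finset.sup_le fun q hq => ?_
      obtain ⟨hqS, hqp⟩ := (hdown p q).1 hq
      exact (hr q hqS p hp hqp).2.1
    · exact Finset.sup_mono_fun fun q _ => hIL q
  · intro p _ q _ hpq
    have : down p ⊆ down q := fun x hx => by
      rw [hdown] at hx ⊢
      exact ⟨hx.1, hx.2.trans hpq⟩
    exact ⟨Finset.sup_mono this, Finset.sup_mono this⟩
  · intro t ht p _ hlt
    have ht0 : ⊥ < t := lt_of_le_of_lt (Nat.zero_le _) hlt
    refine (Finset.sup_lt_iff ht0).2 fun q hq => ?_
    -- An index `q` pushing `Y p` to `t` or beyond has `t ≤ L q`, hence `t ≤ I q`, and so pushes `X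
    -- p` there as well.
    by_contra h
    have htq : t ∈ Θ.filter (· ≤ L q) := Finset.mem_filter.2 ⟨ht, not_lt.1 h⟩
    have h₁ : t ≤ I q := le_max_of_le_right (Finset.le_sup (f := id) htq)
    have h₂ : I q ≤ (down p).sup I := Finset.le_sup hq
    exact absurd hlt (not_lt.2 (h₁.trans h₂))

/-! ### From legal behaviors to witnesses -/

/-- The matching of a legal behavior that respects the precedence order of `ch` is a linearization
witness for `ch`. -/
theorem FifoOrder.isLinearizationWitness {κ : Type*} [LinearOrder κ] {ch : List Action}
    {b : List Event} {M : Event → Option Event} {f : Event → κ} (hF : FifoOrder b M f)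
    (hf : Set.InjOn f {e | e ∈ b}) (hmem : ∀ e, e ∈ events ch ↔ e ∈ b)
    (hprec : ∀ e ∈ b, ∀ e' ∈ b, Precedes ch e e' → f e < f e') :
    IsLinearizationWitness ch M := by
  have hD : ∀ d, d ∈ Deq ch ↔ d ∈ b ∧ d.IsDeq := fun d => by simp [Deq, hmem]
  have hE : ∀ d, d ∈ Enq ch ↔ d ∈ b ∧ d.IsEnq := fun d => by simp [Enq, hmem]
  refine ⟨⟨⟨?_, ?_, ?_, ?_⟩, ?_, ?_⟩, ?_⟩
  · intro d hd e he
    obtain ⟨h₁, h₂, -⟩ := hF.enq_lt d ((hD d).1 hd).1 e he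
    exact (hE e).2 ⟨h₁, h₂⟩
  · intro d hd e he
    exact (hF.enq_lt d ((hD d).1 hd).1 e he).2.2.2.1
  · intro d hd
    exact hF.null_iff d ((hD d).1 hd).1 ((hD d).1 hd).2
  · intro d hd d' hd' heq hne
    obtain ⟨e, he⟩ := Option.ne_none_iff_exists'.1 hne
    exact hF.inj d ((hD d).1 hd).1 d' ((hD d').1 hd').1 e he (heq ▸ he)
  · intro d hd e he hp
    obtain ⟨h₁, -, -, -, h₂⟩ := hF.enq_lt d ((hD d).1 hd).1 e he
    exact lt_asymm h₂ (hprec d ((hD d).1 hd).1 e h₁ hp)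
  · intro e he d' hd' e' he' hp
    obtain ⟨heb, heq⟩ := (hE e).1 he
    have hdb' := ((hD d').1 hd').1
    have he'b := (hF.enq_lt d' hdb' e' he').1
    obtain ⟨d, hd, hde, hlt⟩ := hF.fifo e heb heq d' hdb' e' he' (hprec e heb e' he'b hp)
    exact ⟨d, (hD d).2 ⟨hd, (hF.enq_lt d hd e hde).2.2.1⟩, hde, fun hp' =>
      lt_asymm hlt (hprec d' hdb' d hd hp')⟩
  · intro d₀ hd₀ hv
    obtain ⟨hdb, hdq⟩ := (hD d₀).1 hd₀
    have hbad : ∀ i, ∀ e ∈ BadLevel ch M d₀ i, e ∈ b ∧ f d₀ < f e := by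
      -- Emptiness of the queue at `d₀`: an enqueue not after `d₀` is taken before `d₀`.
      have hback : ∀ e ∈ b, e.IsEnq → ¬ f d₀ < f e → ∃ d ∈ Deq ch, M d = some e ∧ f d < f d₀ := by
        intro e he hq hlt
        have hne : f e ≠ f d₀ := fun h => Event.not_isDeq hq (hf he hdb h ▸ hdq)
        obtain ⟨d, hd, hde, hlt'⟩ :=
          hF.empty d₀ hdb hdq hv e he hq (lt_of_le_of_ne (not_lt.1 hlt) hne)
        exact ⟨d, (hD d).2 ⟨hd, (hF.enq_lt d hd e hde).2.2.1⟩, hde, hlt'⟩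
      intro i
      induction i with
      | zero =>
        rintro e ⟨heE, hcase⟩
        obtain ⟨he, hq⟩ := (hE e).1 heE
        refine ⟨he, ?_⟩
        rcases hcase with hp | hp
        · exact hprec d₀ hdb e he hp
        · by_contra hlt
          obtain ⟨d, hd, hde, hlt'⟩ := hback e he hq hlt
          exact lt_asymm hlt' (hprec d₀ hdb d ((hD d).1 hd).1 (hp d hd hde))
      | succ i ih =>
        rintro e ⟨heE, e', he', hcase⟩
        obtain ⟨he, hq⟩ := (hE e).1 heE
        obtain ⟨he'b, hlt₀⟩ := ih e' he'
        refine ⟨he, ?_⟩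
        rcases hcase with hp | ⟨d, hd, hde, hp⟩
        · exact hlt₀.trans (hprec e' he'b e he hp)
        · by_contra hlt
          obtain ⟨d', hd', hde', hlt'⟩ := hback e he hq hlt
          have hdb' := ((hD d).1 hd).1
          obtain rfl := hF.inj d hdb' d' ((hD d').1 hd').1 e hde hde'
          exact lt_asymm hlt' (hlt₀.trans (hprec e' he'b d hdb' hp))
    refine Set.eq_empty_of_forall_notMem fun e ⟨hB, hev, hp⟩ => ?_
    obtain ⟨i, hi⟩ := Set.mem_iUnion.1 hB
    obtain ⟨he, hlt⟩ := hbad i e hi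
    exact lt_asymm hlt (hprec e he d₀ hdb hp)

theorem mem_events_iff_of_perm {ch : List Action} {b : List Event} (hb : IsBehavior b)
    (hp : ch.Perm (toHistory b)) (e : Event) : e ∈ events ch ↔ e ∈ b := by
  rw [← mem_events_toHistory hb]
  simp [events, hp.mem_iff]

theorem Linearizable.exists_witness {c : List Action} (h : Linearizable queueSpec c) :
    ∃ ch ∈ Compl c, ∃ M, IsLinearizationWitness ch M := by
  obtain ⟨b, ⟨hb, q, hr⟩, -, -, ch, hch, hperm, hprec⟩ := h
  have hnd : b.Nodup := hb.of_map
  have hsorted : b.Pairwise fun x y => b.idxOf x < b.idxOf y := by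
    rw [List.pairwise_iff_getElem]
    intro i j hi hj hij
    rwa [hnd.idxOf_getElem, hnd.idxOf_getElem]
  obtain ⟨M, hF, -⟩ := exists_fifoOrder_of_run hsorted hr
  have hmem := mem_events_iff_of_perm hb hperm
  refine ⟨ch, hch, M, hF.isLinearizationWitness ?_ hmem ?_⟩
  · intro x hx y _ hxy
    exact (List.idxOf_inj hx).1 hxy
  · intro e he e' he' hp
    exact (precedes_toHistory_iff hb he he').1
      (hprec e ((hmem e).2 he) e' ((hmem e').2 he') hp)

/-! ### From witnesses to legal behaviors -/

section Witness

variable {ch : List Action} {M : Event → Option Event}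

/-- Start and end of the dequeue that takes `e`, both `ch.length` if there is none. -/
theorem exists_deq_interval (ch : List Action) (M : Event → Option Event) :
    ∃ a' b' : Event → ℕ, ∀ e ∈ Enq ch,
      (∃ d ∈ Deq ch, M d = some e ∧ a' e = invPos ch d ∧ b' e = resPos ch d) ∨
        (∀ d ∈ Deq ch, M d ≠ some e) ∧ a' e = ch.length ∧ b' e = ch.length := by
  have h : ∀ e, ∃ p : ℕ × ℕ,
      (∃ d ∈ Deq ch, M d = some e ∧ p.1 = invPos ch d ∧ p.2 = resPos ch d) ∨
        (∀ d ∈ Deq ch, M d ≠ some e) ∧ p.1 = ch.length ∧ p.2 = ch.length := by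
    intro e
    by_cases he : ∃ d ∈ Deq ch, M d = some e
    · obtain ⟨d, hd, hde⟩ := he
      exact ⟨(_, _), Or.inl ⟨d, hd, hde, rfl, rfl⟩⟩
    · push Not at he
      exact ⟨(_, _), Or.inr ⟨he, rfl, rfl⟩⟩
  choose p hp using h
  exact ⟨fun e => (p e).1, fun e => (p e).2, fun e _ => hp e⟩

/-- A dequeue of `NULL` can be placed at a time of its interval that separates the good enqueues
from the bad ones. -/
theorem exists_null_time (hw : WellFormed ch) (hM : IsLinearizationWitness ch M) {a' b' : Event → ℕ}
    (hab : ∀ e ∈ Enq ch,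
      (∃ d ∈ Deq ch, M d = some e ∧ a' e = invPos ch d ∧ b' e = resPos ch d) ∨
        (∀ d ∈ Deq ch, M d ≠ some e) ∧ a' e = ch.length ∧ b' e = ch.length)
    {d₀ : Event} (hd₀ : d₀ ∈ Deq ch) (hv : d₀.val = none) :
    ∃ t, invPos ch d₀ ≤ t ∧ t ≤ resPos ch d₀ ∧
      ∀ e ∈ Enq ch, t ≤ max (invPos ch e) (a' e) → t ≤ resPos ch e := by
  have hbadE : ∀ e ∈ Bad ch M d₀, e ∈ Enq ch := by
    intro e he
    obtain ⟨_ | i, hi⟩ := Set.mem_iUnion.1 he <;> exact hi.1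
  have hlate : ∀ e ∈ Bad ch M d₀, invPos ch d₀ ≤ resPos ch e := by
    intro e he
    by_contra hlt
    have : e ∈ Bad ch M d₀ ∩ Before ch d₀ :=
      ⟨he, (hbadE e he).1, (precedes_iff hw.nodup (hbadE e he).1 hd₀.1).2 (not_le.1 hlt)⟩
    rw [hM.null_witness d₀ hd₀ hv] at this
    exact this
  -- The time chosen is the first response among `d₀` and the bad enqueues. It is not before the
  -- invocation of `d₀`, because no bad enqueue precedes `d₀`.
  set A : Set ℕ := insert (resPos ch d₀) (resPos ch '' Bad ch M d₀) with hA
  have hne : A.Nonempty := ⟨_, Set.mem_insert _ _⟩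
  have hmemA := Nat.sInf_mem hne
  have hle : ∀ e ∈ Bad ch M d₀, sInf A ≤ resPos ch e := fun e he =>
    Nat.sInf_le (Set.mem_insert_of_mem _ ⟨e, he, rfl⟩)
  have hunique : ∀ e d d', d ∈ Deq ch → d' ∈ Deq ch → M d = some e → M d' = some e → d = d' :=
    fun e d d' hd hd' h h' => hM.inj d hd d' hd' (h.trans h'.symm) (by simp [h])
  refine ⟨sInf A, ?_, Nat.sInf_le (Set.mem_insert _ _), fun e he ht => hle e ?_⟩
  · rcases hmemA with h | ⟨e, he, h⟩
    · exact h ▸ (hw.invPos_lt_resPos hd₀.1).le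
    · exact h ▸ hlate e he
  rcases hab e he with ⟨d, hd, hde, ha', -⟩ | ⟨hno, -, -⟩
  -- An event responding at the chosen time precedes `e` or its dequeue, which makes `e` bad. The
  -- inequality becomes strict because an invocation and a response never share a position.
  · have hstep : ∀ x ∈ events ch, resPos ch x = sInf A → Precedes ch x e ∨ Precedes ch x d := by
      intro x hx hxA
      rw [precedes_iff hw.nodup hx he.1, precedes_iff hw.nodup hx hd.1, hxA]
      have h₁ := invPos_ne_resPos (e' := x) he.1
      have h₂ := invPos_ne_resPos (e' := x) hd.1
      rw [ha'] at ht
      omega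
    rcases hmemA with h | ⟨x, hx, h⟩
    · refine Set.mem_iUnion.2 ⟨0, he, (hstep d₀ hd₀.1 h.symm).imp_right fun hp d' hd' hde' => ?_⟩
      rwa [hunique e d' d hd' hd hde' hde]
    · obtain ⟨i, hi⟩ := Set.mem_iUnion.1 hx
      exact Set.mem_iUnion.2 ⟨i + 1, he, x, hi,
        (hstep x (hbadE x hx).1 h).imp_right fun hp => ⟨d, hd, hde, hp⟩⟩
  · exact Set.mem_iUnion.2 ⟨0, he, Or.inr fun d hd hde => absurd hde (hno d hd)⟩

/-- The existence of a key by which the events of `ch` can be listed. -/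
theorem IsLinearizationWitness.exists_fifoOrder (hw : WellFormed ch)
    (hM : IsLinearizationWitness ch M) :
    ∃ (M' : Event → Option Event) (f : Event → ℕ ×ₗ ℕ ×ₗ ℕ), Set.InjOn f (events ch) ∧
      (∀ e ∈ events ch, ∀ e' ∈ events ch, Precedes ch e e' → f e < f e') ∧
      ∀ b : List Event, (∀ e, e ∈ b ↔ e ∈ events ch) → FifoOrder b M' f := by
  classical
  obtain ⟨a', b', hab⟩ := exists_deq_interval ch M
  have htime : ∀ d, ∃ t, d ∈ Deq ch → d.val = none →
      invPos ch d ≤ t ∧ t ≤ resPos ch d ∧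
        ∀ e ∈ Enq ch, t ≤ max (invPos ch e) (a' e) → t ≤ resPos ch e := by
    intro d
    by_cases h : d ∈ Deq ch ∧ d.val = none
    · obtain ⟨t, ht⟩ := exists_null_time hw hM hab h.1 h.2
      exact ⟨t, fun _ _ => ht⟩
    · exact ⟨0, fun h₁ h₂ => absurd ⟨h₁, h₂⟩ h⟩
  choose τ hτ using htime
  have hfin := events_finite ch
  have hEfin : (Enq ch).Finite := hfin.subset fun e he => he.1
  have hNfin : {d | d ∈ Deq ch ∧ d.val = none}.Finite := hfin.subset fun e he => he.1.1
  have hunique : ∀ e d d', d ∈ Deq ch → d' ∈ Deq ch → M d = some e → M d' = some e → d = d' :=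
    fun e d d' hd hd' h h' => hM.inj d hd d' hd' (h.trans h'.symm) (by simp [h])
  have hmatched : ∀ d ∈ Deq ch, ∀ e, M d = some e → a' e = invPos ch d ∧ b' e = resPos ch d := by
    intro d hd e hde
    rcases hab e (hM.mapsTo d hd e hde) with ⟨d', hd', hde', h⟩ | ⟨hno, -⟩
    · rwa [hunique e d d' hd hd' hde hde']
    · exact absurd hde (hno d hd)
  obtain ⟨r, X, Y, hr, hXY, hmono, hsep⟩ := exists_schedule hEfin.toFinset (invPos ch) (resPos ch)
    a' b' (hNfin.toFinset.image τ)
    (fun e he => (hw.invPos_lt_resPos ((hEfin.mem_toFinset.1 he).1)).le)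
    (fun e he => by
      rcases hab e (hEfin.mem_toFinset.1 he) with ⟨d, hd, -, h₁, h₂⟩ | ⟨-, h₁, h₂⟩
      · rw [h₁, h₂]
        exact (hw.invPos_lt_resPos hd.1).le
      · rw [h₁, h₂])
    (fun e he => by
      have he := hEfin.mem_toFinset.1 he
      rcases hab e he with ⟨d, hd, hde, h₁, h₂⟩ | ⟨-, h₁, h₂⟩
      · rw [h₂]
        have := mt (precedes_iff hw.nodup hd.1 he.1).2 (hM.not_deq_precedes d hd e hde)
        omega
      · rw [h₂]
        exact ((hw.invPos_lt_resPos he.1).trans (resPos_lt_length he.1)).le)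
    (fun p hp q hq hlt => by
      have hp := hEfin.mem_toFinset.1 hp
      have hq := hEfin.mem_toFinset.1 hq
      rcases hab q hq with ⟨d', hd', hde', -, h₂⟩ | ⟨-, -, h₂⟩
      · obtain ⟨d, hd, hde, hnp⟩ := hM.fifo p hp d' hd' q hde'
          ((precedes_iff hw.nodup hp.1 hq.1).2 hlt)
        rw [precedes_iff hw.nodup hd'.1 hd.1] at hnp
        rw [h₂, (hmatched d hd p hde).1]
        omega
      · rw [h₂]
        rcases hab p hp with ⟨d, hd, -, h₁, -⟩ | ⟨-, h₁, -⟩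
        · rw [h₁]
          exact ((hw.invPos_lt_resPos hd.1).trans (resPos_lt_length hd.1)).le
        · exact h₁.le)
    (fun t ht e he => by
      obtain ⟨d, hd, rfl⟩ := Finset.mem_image.1 ht
      obtain ⟨hd₁, hd₂⟩ := hNfin.mem_toFinset.1 hd
      exact (hτ d hd₁ hd₂).2.2 e (hEfin.mem_toFinset.1 he))
  simp only [Set.Finite.coe_toFinset, Set.Finite.mem_toFinset] at hr hXY hmono
  have hsep' : ∀ d ∈ Deq ch, d.val = none → ∀ e ∈ Enq ch, X e < τ d → Y e < τ d :=
    fun d hd hv e he => hsep _ (Finset.mem_image_of_mem _ (hNfin.mem_toFinset.2 ⟨hd, hv⟩)) e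
      (hEfin.mem_toFinset.2 he)
  clear hsep
  -- At equal times, `NULL` dequeues come first, then enqueues, then matched dequeues. Thus an
  -- enqueue precedes its dequeue even if `X e = Y e`, and only enqueues with `X e` strictly below
  -- the time of a `NULL` dequeue come before it. The rank orders enqueues and matched dequeues
  -- alike.
  let f : Event → ℕ ×ₗ ℕ ×ₗ ℕ := fun a =>
    if a.IsEnq then toLex (X a, toLex (1, r a))
    else match M a with
      | none => toLex (τ a, toLex (0, resPos ch a))
      | some e => toLex (Y e, toLex (2, r e))
  have hfE : ∀ e ∈ Enq ch, f e = toLex (X e, toLex (1, r e)) := fun e he => if_pos he.2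
  have hfD : ∀ d ∈ Deq ch, ∀ e, M d = some e → f d = toLex (Y e, toLex (2, r e)) := by
    intro d hd e hde
    simp only [f]
    rw [if_neg fun h => Event.not_isDeq h hd.2, hde]
  have hfN : ∀ d ∈ Deq ch, M d = none → f d = toLex (τ d, toLex (0, resPos ch d)) := by
    intro d hd hde
    simp only [f]
    rw [if_neg fun h => Event.not_isDeq h hd.2, hde]
  have hcases : ∀ a ∈ events ch, a ∈ Enq ch ∨ (a ∈ Deq ch ∧ ∃ e, e ∈ Enq ch ∧ M a = some e) ∨
      (a ∈ Deq ch ∧ M a = none) := by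
    intro a ha
    rcases a.isEnq_or_isDeq with h | h
    · exact Or.inl ⟨ha, h⟩
    · rcases hMa : M a with _ | e
      · exact Or.inr (Or.inr ⟨⟨ha, h⟩, rfl⟩)
      · exact Or.inr (Or.inl ⟨⟨ha, h⟩, e, hM.mapsTo a ⟨ha, h⟩ e hMa, rfl⟩)
  have hpt : ∀ a ∈ events ch, invPos ch a ≤ (ofLex (f a)).1 ∧ (ofLex (f a)).1 ≤ resPos ch a := by
    intro a ha
    rcases hcases a ha with h | ⟨h, e, he, hae⟩ | ⟨h, hae⟩
    · rw [hfE a h]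
      exact ⟨(hXY a h).1, (hXY a h).2.1⟩
    · rw [hfD a h e hae, ← (hmatched a h e hae).1, ← (hmatched a h e hae).2]
      exact ⟨(hXY e he).2.2.1, (hXY e he).2.2.2.1⟩
    · rw [hfN a h hae]
      have := hτ a h ((hM.null_iff a h).1 hae)
      exact ⟨this.1, this.2.1⟩
  -- A witness is unconstrained outside `Deq ch`, whereas `FifoOrder` requires enqueues to be
  -- unmatched.
  refine ⟨fun a => if a.IsEnq then none else M a, f, ?_, ?_, fun b hb => ?_⟩
  · have hkey : ∀ a ∈ events ch, ∃ t k n, f a = toLex (t, toLex (k, n)) ∧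
        (k = 1 ∧ a ∈ Enq ch ∧ n = r a ∨
          k = 2 ∧ a ∈ Deq ch ∧ (∃ e ∈ Enq ch, M a = some e ∧ n = r e) ∨
          k = 0 ∧ n = resPos ch a) := by
      intro a ha
      rcases hcases a ha with h | ⟨h, e, he, hae⟩ | ⟨h, hae⟩
      · exact ⟨_, _, _, hfE a h, Or.inl ⟨rfl, h, rfl⟩⟩
      · exact ⟨_, _, _, hfD a h e hae, Or.inr (Or.inl ⟨rfl, h, e, he, hae, rfl⟩)⟩
      · exact ⟨_, _, _, hfN a h hae, Or.inr (Or.inr ⟨rfl, rfl⟩)⟩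
    intro a ha c hc hac
    obtain ⟨t, k, n, hfa, hA⟩ := hkey a ha
    obtain ⟨t', k', n', hfc, hC⟩ := hkey c hc
    rw [hfa, hfc] at hac
    simp only [EmbeddingLike.apply_eq_iff_eq, Prod.mk.injEq] at hac
    obtain ⟨-, hk, hn⟩ := hac
    rcases hA with ⟨hk₁, h, hn₁⟩ | ⟨hk₁, h, e, he, hae, hn₁⟩ | ⟨hk₁, hn₁⟩ <;>
    rcases hC with ⟨hk₂, h', hn₂⟩ | ⟨hk₂, h', e', he', hae', hn₂⟩ | ⟨hk₂, hn₂⟩ <;>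
    first
    | omega
    | skip
    · exact hr h h' (by omega)
    · obtain rfl := hr he he' (by omega)
      exact hunique e a c h h' hae hae'
    · exact hw.eq_of_resPos_eq ha hc (by omega)
  · intro e he e' he' hp
    rw [precedes_iff hw.nodup he he'] at hp
    exact Prod.Lex.lt_iff.2 (Or.inl ((hpt e he).2.trans_lt (hp.trans_le (hpt e' he').1)))
  · have hbE : ∀ e, e ∈ Enq ch ↔ e ∈ b ∧ e.IsEnq := fun e => by simp [Enq, hb]
    have hbD : ∀ e, e ∈ Deq ch ↔ e ∈ b ∧ e.IsDeq := fun e => by simp [Deq, hb]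
    have hMD : ∀ d ∈ b, ∀ e, (if d.IsEnq then none else M d) = some e →
        d ∈ Deq ch ∧ M d = some e := by
      intro d hd e hde
      split_ifs at hde with hq
      exact ⟨(hbD d).2 ⟨hd, d.isEnq_or_isDeq.resolve_left hq⟩, hde⟩
    have hMD' : ∀ d ∈ Deq ch, (if d.IsEnq then none else M d) = M d := fun d hd =>
      if_neg fun h => Event.not_isDeq h hd.2
    constructor
    · intro d hd e hde
      obtain ⟨hdD, hde⟩ := hMD d hd e hde
      have he := hM.mapsTo d hdD e hde
      refine ⟨((hbE e).1 he).1, he.2, hdD.2, hM.val_eq d hdD e hde, ?_⟩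
      rw [hfE e he, hfD d hdD e hde, Prod.Lex.toLex_lt_toLex, Prod.Lex.toLex_lt_toLex]
      have := (hXY e he).2.2.2.2
      omega
    · intro d hd hq
      simp only [hMD' d ((hbD d).2 ⟨hd, hq⟩)]
      exact hM.null_iff d ((hbD d).2 ⟨hd, hq⟩)
    · intro d hd d' hd' e hde hde'
      obtain ⟨hdD, hde⟩ := hMD d hd e hde
      obtain ⟨hdD', hde'⟩ := hMD d' hd' e hde'
      exact hunique e d d' hdD hdD' hde hde'
    · intro e he hq d' hd' e' hde' hlt
      obtain ⟨hdD', hde'⟩ := hMD d' hd' e' hde'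
      have heE := (hbE e).2 ⟨he, hq⟩
      have heE' := hM.mapsTo d' hdD' e' hde'
      have hrr : r e < r e' := by
        rw [hfE e heE, hfE e' heE', Prod.Lex.toLex_lt_toLex, Prod.Lex.toLex_lt_toLex] at hlt
        by_contra hle
        have := (hmono e' heE' e heE (not_lt.1 hle)).1
        omega
      have hYY := (hmono e heE e' heE' hrr.le).2
      rcases hab e heE with ⟨d, hd, hde, -⟩ | ⟨-, ha, -⟩
      · refine ⟨d, ((hbD d).1 hd).1, (hMD' d hd).trans hde, ?_⟩
        rw [hfD d hd e hde, hfD d' hdD' e' hde', Prod.Lex.toLex_lt_toLex,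
          Prod.Lex.toLex_lt_toLex]
        omega
      -- An enqueue that is never taken has `Y e` at least `ch.length`, past every response, so it
      -- cannot be ranked before the matched `e'`.
      · have h₁ := (hXY e heE).2.2.1
        have h₂ := (hXY e' heE').2.2.2.1
        rw [(hmatched d' hdD' e' hde').2] at h₂
        have h₃ := resPos_lt_length hdD'.1
        omega
    · intro d hd hq hv e he hqe hlt
      have hdD := (hbD d).2 ⟨hd, hq⟩
      have heE := (hbE e).2 ⟨he, hqe⟩
      have hMd := (hM.null_iff d hdD).2 hv
      have hX : X e < τ d := by
        rw [hfE e heE, hfN d hdD hMd, Prod.Lex.toLex_lt_toLex, Prod.Lex.toLex_lt_toLex] at hlt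
        omega
      have hY := hsep' d hdD hv e heE hX
      rcases hab e heE with ⟨d', hd', hde', -⟩ | ⟨-, ha, -⟩
      · refine ⟨d', ((hbD d').1 hd').1, (hMD' d' hd').trans hde', ?_⟩
        rw [hfD d' hd' e hde', hfN d hdD hMd, Prod.Lex.toLex_lt_toLex]
        exact Or.inl hY
      -- An enqueue that is never taken cannot lie before a `NULL` dequeue: `Y e < τ d` would put
      -- `ch.length` below a position in `ch`.
      · have h₁ := (hXY e heE).2.2.1
        have h₂ := (hτ d hdD hv).2.1
        have h₃ := resPos_lt_length hdD.1
        omega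

theorem IsLinearizationWitness.linearizable {c : List Action} (hch : ch ∈ Compl c)
    (hM : IsLinearizationWitness ch M) : Linearizable queueSpec c := by
  have hw : WellFormed ch := hch.1
  obtain ⟨M', f, hinj, hprec, hF⟩ := hM.exists_fifoOrder hw
  obtain ⟨b, hb, hsorted⟩ := exists_sorted (events_finite ch).toFinset f (by simpa using hinj)
  simp only [Set.Finite.mem_toFinset] at hb
  have hnd : b.Nodup := hsorted.imp fun h heq => by subst heq; exact lt_irrefl _ h
  have hbeh : IsBehavior b := List.Nodup.map_on
    (fun x hx y hy hxy => hw.event_eq ((hb x).1 hx) ((hb y).1 hy) hxy) hnd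
  have hwb := wellFormed_toHistory hbeh
  refine ⟨b, ⟨hbeh, _, (hF b hb).run_of_prefix hsorted List.prefix_rfl⟩, hwb,
    sequential_toHistory b, ch, hch, ?_, ?_⟩
  · rw [List.perm_ext_iff_of_nodup hw.nodup hwb.nodup]
    intro a
    simp only [mem_iff_of_complete hw hch.2.1, mem_toHistory, hb]
  · intro e he e' he' hp
    rw [precedes_toHistory_iff hbeh ((hb e).2 he) ((hb e').2 he')]
    by_contra hle
    have hlt := hprec e he e' he' hp
    rcases (not_lt.1 hle).lt_or_eq with h | h
    · have := List.pairwise_iff_getElem.1 hsorted _ _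
        (List.idxOf_lt_length_of_mem ((hb e').2 he')) (List.idxOf_lt_length_of_mem ((hb e).2 he)) h
      rw [List.getElem_idxOf, List.getElem_idxOf] at this
      exact lt_asymm hlt this
    · rw [(List.idxOf_inj ((hb e').2 he')).1 h] at hlt
      exact lt_irrefl _ hlt

end Witness

end QueueLin

theorem mainTheorem1 (C : Set (List QueueLin.Action))
    (hC : ∀ c ∈ C, QueueLin.WellFormed c) :
    QueueLin.LinearizableSet QueueLin.queueSpec C ↔
      ∀ c ∈ C, ∃ ch ∈ QueueLin.Compl c, ∃ M : QueueLin.Event → Option QueueLin.Event,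
        QueueLin.IsLinearizationWitness ch M := by
  refine forall₂_congr fun c _ => ⟨QueueLin.Linearizable.exists_witness, ?_⟩
  rintro ⟨ch, hch, M, hM⟩
  exact hM.linearizable hch
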